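/- Let $q$ be an indeterminate and, for $N\ge 0$, put $(t)_N=(1-t)(1-tq)\cdots(1-tq^{N-1})$. Let $n$ be a positive integer. For a matrix $B=(\beta_{ij})_{0\le i,j\le n}$ of nonnegative integers with zero diagonal let \[ L_q(x_0,\mathbf{x};B)=\prod_{0\le i<j\le n}\left(\frac{x_i}{x_j}\right)_{\beta_{ij}}\left(\frac{q x_j}{x_i}\right)_{\beta_{ji}}, \] a Laurent polynomial in $x_0$ and $\mathbf{x}=(x_1,\dots,x_n)$ with coefficients in $\mathbb{Q}(q)$. For integers $a,b,k\ge 0$ and $0\le m\le n$ let $B_A$ be the matrix with $\beta_{ii}=0$ for $0\le i\le n$; $\beta_{0j}=b$ for $1\le j\le n$; $\beta_{i0}=a$ for $1\le i\le n-m$; $\beta_{i0}=a+1$ for $n-m<i\le n$; and $\beta_{ij}=k$ for $1\le i\ne j\le n$. Write $\chi(S)=1$ if the statement $S$ is true and $\chi(S)=0$ otherwise. Then, for all integers $a,b,k\ge 0$ and $0\le m\le n$, the constant term of $L_q(x_0,\mathbf{x};B_A)$ (the coefficient of $x_0^0x_1^0\cdots x_n^0$) is \[ \mathrm{CT}\left[L_q(x_0,\mathbf{x};B_A)\right]=\prod_{j=0}^{n-1}\frac{(q)_{a+b+kj+\chi(j\ge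 n-m)}\,(q)_{kj+k}}{(q)_{a+kj+\chi(j\ge n-m)}\,(q)_{b+kj}\,(q)_k}. \] -/

import Mathlib

/-- The `q`-shifted factorial `(t)_N = (1 - t)(1 - t q) ⋯ (1 - t q^(N-1))`. -/
def qShifted {R : Type*} [CommRing R] (q t : R) (N : ℕ) : R :=
  ∏ s ∈ Finset.range N, (1 - t * q ^ s)

/-- Laurent polynomials in the variables `x_0, …, x_n` with coefficients in `R`: the group
algebra of the exponent lattice `ℤ^(n+1)`. -/
abbrev LaurentPoly (R : Type*) [CommRing R] (n : ℕ) : Type _ :=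
  AddMonoidAlgebra R (Fin (n + 1) → ℤ)

/-- The constant `c`, seen as a Laurent polynomial. -/
noncomputable def laurentConst {R : Type*} [CommRing R] {n : ℕ} (c : R) : LaurentPoly R n :=
  AddMonoidAlgebra.single 0 c

/-- The Laurent monomial `x_i / x_j`. -/
noncomputable def laurentRatio {R : Type*} [CommRing R] {n : ℕ} (i j : Fin (n + 1)) :
    LaurentPoly R n :=
  AddMonoidAlgebra.single (Pi.single i 1 - Pi.single j 1) 1

/-- The constant term of a Laurent polynomial, i.e. the coefficient of `x_0^0 ⋯ x_n^0`. -/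
def constTerm {R : Type*} [CommRing R] {n : ℕ} (f : LaurentPoly R n) : R :=
  f.coeff 0

/-- `L_q(x_0, x; B) = ∏_{0 ≤ i < j ≤ n} (x_i / x_j)_{β_ij} (q x_j / x_i)_{β_ji}`. -/
noncomputable def laurentL {R : Type*} [CommRing R] (q : R) {n : ℕ}
    (B : Matrix (Fin (n + 1)) (Fin (n + 1)) ℕ) : LaurentPoly R n :=
  ∏ i : Fin (n + 1), ∏ j ∈ Finset.Ioi i,
    qShifted (laurentConst q) (laurentRatio i j) (B i j) *
      qShifted (laurentConst q) (laurentConst q * laurentRatio j i) (B j i)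

/-- The matrix `B_A`, with rows and columns numbered from `0` to `n`: zero diagonal, remaining
entries of row `0` equal to `b`, remaining entries of column `0` equal to `a` in the rows
`1, …, n - m` and to `a + 1` in the last `m` rows, all other entries equal to `k`. -/
def matrixA (n m a b k : ℕ) : Matrix (Fin (n + 1)) (Fin (n + 1)) ℕ :=
  Matrix.of fun i j =>
    if i = j then 0
    else if i = 0 then b
    else if j = 0 then (if n - m < (i : ℕ) then a + 1 else a)
    else k

/-! Clearing denominators turns the constant term into the coefficient of `x_0^d x_1^D ⋯ x_n^D` in
`dysonPoly`, of total degree at most `d + n * D`, where `D = b + (n - 1) * k` and `d` is the sum of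
column 0 of the matrix.

Interpolate in `x_1, …, x_n` only, at the nodes `q^0, …, q^D`, keeping `x_0 = X` free. The weighted
sum of the specializations at `x_j = q^(α j)` is a polynomial in `X` of degree at most `d` whose
coefficient at `X^d` is the number sought (`partialLagrange_spec`). A specialization vanishes unless
`α` is spread (`prod_pairs_eq_zero`), and for spread `α` it is divisible by the fixed monic
polynomial `nodePoly` of degree `d` (`nodePoly_dvd`). Hence the sum is the wanted coefficient times
`nodePoly`.

Evaluating at `X = 1` isolates one node: the factors `x_j - q^t x_0` with `t < b` kill every `α`
having some `α j < b`, and a spread `α` with values in `[b, D]` must be `α j = b + j * k`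
(`IsSpread.eq_of_le`). The surviving term and `nodePoly` at 1 are explicit products. -/

/-! ### Interpolation in all variables but one -/

open Finset Polynomial in
/-- Interpolation in all variables but the first. -/
noncomputable def partialLagrange {K : Type*} [Field K] {n : ℕ} (v : ℕ → K) (D : ℕ)
    (F : MvPolynomial (Fin (n + 1)) K) : K[X] :=
  ∑ α ∈ Fintype.piFinset (fun _ : Fin n => range (D + 1)),
    C (∏ j, (∏ s ∈ (range (D + 1)).erase (α j), (v (α j) - v s))⁻¹) *
      MvPolynomial.aeval (Fin.cons X (fun j => C (v (α j))) : Fin (n + 1) → K[X]) F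

-- For `e ≤ D` the polynomial `X^e` is its own interpolant at `D + 1` nodes, and the sum is the
-- coefficient of that interpolant at `X^D`.
open Finset Polynomial in
theorem sum_pow_mul_lagrange {K : Type*} [Field K] {v : ℕ → K} {D e : ℕ}
    (hv : Set.InjOn v (range (D + 1))) (he : e ≤ D) :
    ∑ s ∈ range (D + 1), (∏ t ∈ (range (D + 1)).erase s, (v s - v t))⁻¹ * v s ^ e =
      if e = D then 1 else 0 := by
  have h := Lagrange.coeff_eq_sum (s := range (D + 1)) (v := v) hv (P := (X ^ e : K[X]))
    (by rw [degree_X_pow, card_range]; exact_mod_cast Nat.lt_succ_of_le he)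
  rw [card_range, Nat.add_sub_cancel, coeff_X_pow] at h
  simp only [eq_comm (a := e)]
  rw [h]
  refine sum_congr rfl fun s _ => ?_
  rw [eval_pow, eval_X, div_eq_mul_inv, mul_comm]

open Finset Polynomial in
theorem partialLagrange_eq_sum {K : Type*} [Field K] {n : ℕ} (v : ℕ → K) (D : ℕ)
    (F : MvPolynomial (Fin (n + 1)) K) :
    partialLagrange v D F = ∑ e ∈ F.support,
      C (F.coeff e * ∏ j : Fin n, ∑ s ∈ range (D + 1),
        (∏ t ∈ (range (D + 1)).erase s, (v s - v t))⁻¹ * v s ^ e j.succ) * X ^ e 0 := by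
  have key : ∀ α : Fin n → ℕ,
      MvPolynomial.aeval (Fin.cons X (fun j => C (v (α j))) : Fin (n + 1) → K[X]) F =
        ∑ e ∈ F.support, C (F.coeff e * ∏ j : Fin n, v (α j) ^ e j.succ) * X ^ e 0 := by
    intro α
    rw [MvPolynomial.aeval_def, MvPolynomial.eval₂_eq']
    refine sum_congr rfl fun e _ => ?_
    rw [Fin.prod_univ_succ]
    simp only [Fin.cons_zero, Fin.cons_succ, map_mul, map_prod, map_pow, algebraMap_eq]
    ring
  unfold partialLagrange
  simp only [key, mul_sum]
  rw [sum_comm]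
  refine sum_congr rfl fun e _ => ?_
  rw [prod_univ_sum, map_mul, map_sum, mul_sum, sum_mul]
  refine sum_congr rfl fun α _ => ?_
  rw [prod_mul_distrib, map_mul, map_mul]
  ring

-- The weights kill every monomial with some exponent `e j.succ < D`. For the others the degree
-- bound forces `e 0 ≤ d`, with equality only when all remaining exponents equal `D`. Weights with
-- an exponent above `D` never need to be computed.
open Finset Polynomial in
theorem partialLagrange_spec {K : Type*} [Field K] {n : ℕ} {v : ℕ → K} {D d : ℕ}
    (hv : Set.InjOn v (range (D + 1))) {F : MvPolynomial (Fin (n + 1)) K}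
    (hF : F.totalDegree ≤ d + n * D) :
    (partialLagrange v D F).natDegree ≤ d ∧
      (partialLagrange v D F).coeff d =
        F.coeff (Finsupp.equivFunOnFinite.symm (Fin.cons d fun _ => D)) := by
  set w : (Fin (n + 1) →₀ ℕ) → K := fun e => ∏ j : Fin n, ∑ s ∈ range (D + 1),
        (∏ t ∈ (range (D + 1)).erase s, (v s - v t))⁻¹ * v s ^ e j.succ with hw
  have hdeg : ∀ e ∈ F.support, e 0 + ∑ j : Fin n, e j.succ ≤ d + n * D := by
    intro e he
    have := (MvPolynomial.le_totalDegree he).trans hF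
    rwa [Finsupp.sum_fintype _ _ (fun _ => rfl), Fin.sum_univ_succ] at this
  have hge : ∀ e, w e ≠ 0 → ∀ j : Fin n, D ≤ e j.succ := by
    intro e he j
    by_contra! hlt
    refine he (prod_eq_zero (mem_univ j) ?_)
    rw [sum_pow_mul_lagrange hv hlt.le, if_neg hlt.ne]
  have hsum : ∀ e : Fin (n + 1) →₀ ℕ, (∀ j : Fin n, D ≤ e j.succ) →
      n * D ≤ ∑ j : Fin n, e j.succ := by
    intro e he
    simpa using card_nsmul_le_sum univ (fun j : Fin n => e j.succ) D (fun j _ => he j)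
  have h0 : ∀ e ∈ F.support, w e ≠ 0 → e 0 ≤ d := by
    intro e he hwe
    have h1 := hdeg e he
    have h2 := hsum e (hge e hwe)
    omega
  rw [partialLagrange_eq_sum]
  constructor
  · refine natDegree_sum_le_of_forall_le _ _ fun e he => ?_
    by_cases hwe : w e = 0
    · simp only [hw] at hwe
      simp [hwe]
    · exact (natDegree_C_mul_X_pow_le _ _).trans (h0 e he hwe)
  · rw [finsetSum_coeff]
    set δ : Fin (n + 1) →₀ ℕ := Finsupp.equivFunOnFinite.symm (Fin.cons d fun _ => D) with hδ
    have hwδ : w δ = 1 := by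
      refine prod_eq_one fun j _ => ?_
      have : δ j.succ = D := by simp [hδ]
      rw [this, sum_pow_mul_lagrange hv le_rfl, if_pos rfl]
    have hδ0 : δ 0 = d := by simp [hδ]
    rw [sum_eq_single δ]
    · change (C (F.coeff δ * w δ) * X ^ δ 0).coeff d = _
      rw [hwδ, hδ0, coeff_C_mul_X_pow, if_pos rfl, mul_one]
    · intro e he hne
      change (C (F.coeff e * w e) * X ^ e 0).coeff d = _
      rw [coeff_C_mul_X_pow]
      split_ifs with hd
      · by_cases hwe : w e = 0
        · rw [hwe, mul_zero]
        · refine absurd ?_ hne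
          have h1 := hdeg e he
          have h2 := hge e hwe
          have h3 : ∀ j ∈ univ, e (Fin.succ j) = D := by
            have h4 : ∑ j : Fin n, D = ∑ j : Fin n, e j.succ := by
              refine le_antisymm (sum_le_sum fun j _ => h2 j) ?_
              simp only [sum_const, card_univ, Fintype.card_fin, smul_eq_mul]
              omega
            exact fun j hj => (((sum_eq_sum_iff_of_le fun j _ => h2 j).1 h4) j hj).symm
          ext i
          refine Fin.cases ?_ (fun j => ?_) i
          · rw [hδ0, hd]
          · rw [h3 j (mem_univ j)]; simp [hδ]
      · rfl
    · intro h
      change (C (F.coeff δ * w δ) * X ^ δ 0).coeff d = _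
      rw [MvPolynomial.notMem_support_iff.1 h]
      simp

open Finset Polynomial in
/-- If every partial specialization at the nodes is divisible by a monic polynomial of the right
degree, a top coefficient is obtained from the values at any further point `x`. -/
theorem coeff_mul_eval_eq_sum {K : Type*} [Field K] {n : ℕ} {v : ℕ → K} {D d : ℕ}
    (hv : Set.InjOn v (range (D + 1))) {F : MvPolynomial (Fin (n + 1)) K}
    (hF : F.totalDegree ≤ d + n * D) {Φ : K[X]} (hΦ : Φ.Monic) (hd : Φ.natDegree = d)
    (hdvd : ∀ α ∈ Fintype.piFinset (fun _ : Fin n => range (D + 1)),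
      Φ ∣ MvPolynomial.aeval (Fin.cons X (fun j => C (v (α j))) : Fin (n + 1) → K[X]) F) (x : K) :
    F.coeff (Finsupp.equivFunOnFinite.symm (Fin.cons d fun _ => D)) * Φ.eval x =
      ∑ α ∈ Fintype.piFinset (fun _ : Fin n => range (D + 1)),
        (∏ j, (∏ s ∈ (range (D + 1)).erase (α j), (v (α j) - v s))⁻¹) *
          MvPolynomial.eval (Fin.cons x (fun j => v (α j)) : Fin (n + 1) → K) F := by
  obtain ⟨h1, h2⟩ := partialLagrange_spec hv hF
  have h3 : Φ ∣ partialLagrange v D F :=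
    dvd_sum fun α hα => Dvd.dvd.mul_left (hdvd α hα) _
  have h4 : partialLagrange v D F = C ((partialLagrange v D F).coeff d) * Φ := by
    obtain ⟨r, hr⟩ := h3
    by_cases hr0 : r = 0
    · rw [hr, hr0]; simp
    · have h5 : Φ.natDegree + r.natDegree ≤ d := by
        rw [← hΦ.natDegree_mul' hr0, ← hr]; exact h1
      have h6 : r.natDegree = 0 := by omega
      obtain ⟨c, rfl⟩ := natDegree_eq_zero.1 h6
      rw [hr, coeff_mul_C, ← hd, hΦ.coeff_natDegree, one_mul, mul_comm]
  rw [← h2]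
  have h5 := congrArg (eval x) h4
  rw [eval_mul, eval_C] at h5
  rw [← h5, partialLagrange, eval_finsetSum]
  refine sum_congr rfl fun α _ => ?_
  rw [eval_mul, eval_C]
  congr 1
  rw [MvPolynomial.aeval_def, ← coe_evalRingHom, MvPolynomial.hom_eval₂, MvPolynomial.eval,
    MvPolynomial.coe_eval₂Hom]
  congr 1
  · ext; simp
  · funext i
    refine Fin.cases ?_ (fun j => ?_) i <;> simp

/-! ### From Laurent polynomials to a polynomial coefficient -/

open Finset in
/-- The homogeneous polynomial obtained from `laurentL` by clearing denominators. -/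
noncomputable def dysonPoly {K : Type*} [Field K] (q : K) {n : ℕ}
    (B : Matrix (Fin (n + 1)) (Fin (n + 1)) ℕ) : MvPolynomial (Fin (n + 1)) K :=
  ∏ i : Fin (n + 1), ∏ j ∈ Ioi i,
    ((∏ t ∈ range (B i j), (MvPolynomial.X j - MvPolynomial.C (q ^ t) * MvPolynomial.X i)) *
      ∏ t ∈ range (B j i), (MvPolynomial.X i - MvPolynomial.C (q ^ (t + 1)) * MvPolynomial.X j))

/-- The monomial `x_i`. -/
noncomputable def laurentVar {K : Type*} [Field K] {n : ℕ} (i : Fin (n + 1)) : LaurentPoly K n :=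
  AddMonoidAlgebra.single (Pi.single i 1) 1

theorem laurentVar_pow {K : Type*} [Field K] {n : ℕ} (i : Fin (n + 1)) (m : ℕ) :
    (laurentVar i : LaurentPoly K n) ^ m = AddMonoidAlgebra.single (Pi.single i (m : ℤ)) 1 := by
  rw [laurentVar, AddMonoidAlgebra.single_pow, one_pow, ← Pi.single_smul]
  simp

theorem prod_laurentVar_pow {K : Type*} [Field K] {n : ℕ} (e : Fin (n + 1) → ℕ) :
    ∏ i, (laurentVar i : LaurentPoly K n) ^ e i =
      AddMonoidAlgebra.single (fun i => (e i : ℤ)) 1 := by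
  have h : ∀ s : Finset (Fin (n + 1)), ∏ i ∈ s, (laurentVar i : LaurentPoly K n) ^ e i =
      AddMonoidAlgebra.single (∑ i ∈ s, Pi.single i (e i : ℤ)) 1 := by
    intro s
    induction s using Finset.induction_on with
    | empty => rfl
    | insert i s hi ih =>
      rw [Finset.prod_insert hi, Finset.sum_insert hi, ih, laurentVar_pow,
        AddMonoidAlgebra.single_mul_single, one_mul]
  rw [h, Finset.univ_sum_single]

theorem coeff_aeval_laurentVar {K : Type*} [Field K] {n : ℕ} (F : MvPolynomial (Fin (n + 1)) K)
    (d : Fin (n + 1) → ℕ) :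
    (MvPolynomial.aeval (fun i => (laurentVar i : LaurentPoly K n)) F).coeff
      (fun i => (d i : ℤ)) = F.coeff (Finsupp.equivFunOnFinite.symm d) := by
  rw [MvPolynomial.aeval_def, MvPolynomial.eval₂_eq']
  simp only [prod_laurentVar_pow, AddMonoidAlgebra.coe_algebraMap, Function.comp_apply,
    AddMonoidAlgebra.single_mul_single, zero_add, mul_one]
  rw [AddMonoidAlgebra.coeff_sum, Finsupp.finsetSum_apply]
  rw [Finset.sum_eq_single (Finsupp.equivFunOnFinite.symm d)]
  · simp
  · intro e _ hne
    rw [AddMonoidAlgebra.coeff_single, Finsupp.single_apply, if_neg]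
    intro h
    apply hne
    ext i
    have := congrFun h i
    simpa using this
  · intro h
    rw [AddMonoidAlgebra.coeff_single, Finsupp.single_apply, if_pos (by simp)]
    simpa using MvPolynomial.notMem_support_iff.1 h

theorem laurentRatio_mul_laurentVar {K : Type*} [Field K] {n : ℕ} (i j : Fin (n + 1)) :
    (laurentRatio i j : LaurentPoly K n) * laurentVar j = laurentVar i := by
  rw [laurentRatio, laurentVar, laurentVar, AddMonoidAlgebra.single_mul_single]
  simp

theorem laurentConst_pow_mul {K : Type*} [Field K] {n : ℕ} (q : K) (t : ℕ) (x : LaurentPoly K n) :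
    (laurentConst q : LaurentPoly K n) ^ t * x = algebraMap K _ (q ^ t) * x := by
  rw [laurentConst, AddMonoidAlgebra.single_pow, smul_zero]
  rfl

open Finset in
theorem aeval_dysonPoly {K : Type*} [Field K] (q : K) {n : ℕ}
    (B : Matrix (Fin (n + 1)) (Fin (n + 1)) ℕ) :
    MvPolynomial.aeval (fun i => (laurentVar i : LaurentPoly K n)) (dysonPoly q B) =
      laurentL q B *
        ∏ i : Fin (n + 1), ∏ j ∈ Ioi i, (laurentVar j ^ B i j * laurentVar i ^ B j i) := by
  rw [dysonPoly, laurentL, map_prod, ← prod_mul_distrib]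
  refine prod_congr rfl fun i _ => ?_
  rw [map_prod, ← prod_mul_distrib]
  refine prod_congr rfl fun j _ => ?_
  -- One copy of `y` goes into each of the `N` factors, so `y = x_j`, `u = x_i / x_j` leaves `x_j -
  -- q^t x_i`.
  have h : ∀ (y u : LaurentPoly K n) (N : ℕ),
      qShifted (laurentConst q) u N * y ^ N =
        ∏ t ∈ range N, (y - laurentConst q ^ t * (u * y)) := by
    intro y u N
    rw [qShifted, ← card_range N, ← prod_const, card_range, ← prod_mul_distrib]
    exact prod_congr rfl fun t _ => by ring
  rw [mul_mul_mul_comm, h, h, map_mul, map_prod, map_prod, mul_assoc (laurentConst q),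
    laurentRatio_mul_laurentVar, laurentRatio_mul_laurentVar]
  congr 1
  · refine prod_congr rfl fun t _ => ?_
    rw [laurentConst_pow_mul]
    simp
  · refine prod_congr rfl fun t _ => ?_
    rw [← mul_assoc, ← pow_succ, laurentConst_pow_mul]
    simp

open Finset in
theorem totalDegree_dysonPoly_le {K : Type*} [Field K] (q : K) {n : ℕ}
    (B : Matrix (Fin (n + 1)) (Fin (n + 1)) ℕ) :
    (dysonPoly q B).totalDegree ≤ ∑ i : Fin (n + 1), ∑ j ∈ Ioi i, (B i j + B j i) := by
  have h : ∀ (i j : Fin (n + 1)) (c : K),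
      (MvPolynomial.X i - MvPolynomial.C c * MvPolynomial.X j :
        MvPolynomial (Fin (n + 1)) K).totalDegree ≤ 1 := by
    intro i j c
    refine (MvPolynomial.totalDegree_sub _ _).trans (max_le (MvPolynomial.totalDegree_X _).le ?_)
    refine (MvPolynomial.totalDegree_mul _ _).trans ?_
    rw [MvPolynomial.totalDegree_C, MvPolynomial.totalDegree_X]
  refine (MvPolynomial.totalDegree_finsetProd _ _).trans (sum_le_sum fun i _ => ?_)
  refine (MvPolynomial.totalDegree_finsetProd _ _).trans (sum_le_sum fun j _ => ?_)
  refine (MvPolynomial.totalDegree_mul _ _).trans (add_le_add ?_ ?_)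
  · refine (MvPolynomial.totalDegree_finsetProd _ _).trans ((sum_le_sum fun t _ => h _ _ _).trans ?_)
    simp
  · refine (MvPolynomial.totalDegree_finsetProd _ _).trans ((sum_le_sum fun t _ => h _ _ _).trans ?_)
    simp

open Finset in
theorem prod_laurentVar_pow_eq {K : Type*} [Field K] {n : ℕ}
    {B : Matrix (Fin (n + 1)) (Fin (n + 1)) ℕ} (hB : ∀ i, B i i = 0) :
    ∏ i : Fin (n + 1), ∏ j ∈ Ioi i,
        ((laurentVar j : LaurentPoly K n) ^ B i j * laurentVar i ^ B j i) =
      AddMonoidAlgebra.single (fun j => ((∑ i, B i j : ℕ) : ℤ)) 1 := by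
  rw [← prod_laurentVar_pow (fun j => ∑ i, B i j)]
  simp only [← prod_pow_eq_pow_sum, prod_mul_distrib]
  have h1 : ∀ f : Fin (n + 1) → Fin (n + 1) → LaurentPoly K n,
      ∏ i, ∏ j ∈ Ioi i, f j i = ∏ i, ∏ j ∈ Iio i, f i j := by
    intro f
    exact prod_comm' (by simp)
  rw [h1 (fun j i => laurentVar j ^ B i j), ← prod_mul_distrib]
  refine prod_congr rfl fun j _ => ?_
  have h2 : (univ : Finset (Fin (n + 1))) = insert j (Iio j ∪ Ioi j) := by
    ext i
    simp only [mem_univ, mem_insert, mem_union, mem_Iio, mem_Ioi, true_iff]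
    exact (lt_trichotomy i j).elim (fun h => .inr (.inl h)) (fun h => h.elim .inl (.inr ∘ .inr))
  rw [h2, prod_insert (by simp), hB, pow_zero, one_mul, prod_union]
  exact disjoint_left.2 fun i h h' => (mem_Iio.1 h).asymm (mem_Ioi.1 h')

open Finset in
theorem sum_Ioi_eq {n : ℕ} {B : Matrix (Fin (n + 1)) (Fin (n + 1)) ℕ} (hB : ∀ i, B i i = 0) :
    ∑ i : Fin (n + 1), ∑ j ∈ Ioi i, (B i j + B j i) = ∑ j, ∑ i, B i j := by
  simp only [sum_add_distrib]
  have h1 : ∀ f : Fin (n + 1) → Fin (n + 1) → ℕ,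
      ∑ i, ∑ j ∈ Ioi i, f j i = ∑ i, ∑ j ∈ Iio i, f i j := by
    intro f
    exact sum_comm' (by simp)
  rw [h1 (fun j i => B i j), ← sum_add_distrib]
  refine sum_congr rfl fun j _ => ?_
  have h2 : (univ : Finset (Fin (n + 1))) = insert j (Iio j ∪ Ioi j) := by
    ext i
    simp only [mem_univ, mem_insert, mem_union, mem_Iio, mem_Ioi, true_iff]
    exact (lt_trichotomy i j).elim (fun h => .inr (.inl h)) (fun h => h.elim .inl (.inr ∘ .inr))
  rw [h2, sum_insert (by simp), hB, zero_add, sum_union]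
  exact disjoint_left.2 fun i h h' => (mem_Iio.1 h).asymm (mem_Ioi.1 h')

open Finset in
/-- The constant term of `laurentL` is a coefficient of `dysonPoly`. -/
theorem constTerm_laurentL {K : Type*} [Field K] (q : K) {n : ℕ}
    {B : Matrix (Fin (n + 1)) (Fin (n + 1)) ℕ} (hB : ∀ i, B i i = 0) :
    constTerm (laurentL q B) =
      (dysonPoly q B).coeff (Finsupp.equivFunOnFinite.symm fun j => ∑ i, B i j) := by
  rw [← coeff_aeval_laurentVar, aeval_dysonPoly, prod_laurentVar_pow_eq hB,
    AddMonoidAlgebra.coeff_mul_single_eq_coeff_mul (0 : Fin (n + 1) → ℤ)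
      (fun m _ => by simp), mul_one, constTerm]

/-! ### Combinatorics of spread exponents -/

open Finset in
/-- `α` has gaps at least `k` along ascents and at least `k + 1` along descents. -/
def IsSpread {n : ℕ} (k : ℕ) (α : Fin n → ℕ) : Prop :=
  ∀ i j, i < j → α i + k ≤ α j ∨ α j + k + 1 ≤ α i

open Finset in
theorem IsSpread.exists_max {n k : ℕ} {α : Fin n → ℕ} (hα : IsSpread k α) {lo : ℕ}
    (N : ℕ) (S : Finset (Fin n)) (hcard : #S = N + 1) (hlo : ∀ i ∈ S, lo ≤ α i) :
    ∃ j ∈ S, (∀ i ∈ S, α i ≤ α j) ∧ lo + N * k ≤ α j ∧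
      (∀ i ∈ S, j < i → lo + N * k + 1 ≤ α j) := by
  induction N generalizing S with
  | zero =>
    obtain ⟨j, rfl⟩ := card_eq_one.1 hcard
    refine ⟨j, by simp, by simp, by simpa using hlo, ?_⟩
    intro i hi hij
    rw [mem_singleton] at hi
    exact absurd hij (by simp [hi])
  | succ N ih =>
    -- For `k = 0` values may tie along ascents; a tie goes to the larger index, so every later
    -- index in `S` has a strictly smaller value.
    obtain ⟨j, hj, hmax⟩ := exists_max_image S (fun i => toLex (α i, i))
      (card_pos.1 (by omega))
    have hmax' : ∀ i ∈ S, α i < α j ∨ α i = α j ∧ i ≤ j := fun i hi => by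
      have := hmax i hi
      rwa [Prod.Lex.toLex_le_toLex] at this
    obtain ⟨j', hj', hm', hle, hdesc⟩ := ih (S.erase j) (by rw [card_erase_of_mem hj, hcard]; rfl)
      (fun i hi => hlo i (mem_of_mem_erase hi))
    have hne := ne_of_mem_erase hj'
    have hj'S := mem_of_mem_erase hj'
    have hNk : (N + 1) * k = N * k + k := by ring
    have hjj := hmax' j' hj'S
    refine ⟨j, hj, fun i hi => ?_, ?_, ?_⟩
    · rcases hmax' i hi with h | h <;> omega
    · rcases lt_or_gt_of_ne hne with h | h
      · rcases hα _ _ h with h' | h' <;> omega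
      · rcases hα _ _ h with h' | h' <;> omega
    · intro i hi hij
      rcases lt_or_gt_of_ne hne with h | h
      · have := hdesc i (mem_erase.2 ⟨hij.ne', hi⟩) (h.trans hij)
        rcases hα _ _ h with h' | h' <;> omega
      · rcases hα _ _ h with h' | h' <;> omega

-- If `M + 1` values are at least `v + b`, the largest is at least `v + b + M * k`. The upper bound
-- then gives `v ≤ (n - 1 - M) * k`, so the last `M + 1` indices are counted on the right.
open Finset in
theorem IsSpread.card_filter_ge_le {n k : ℕ} {α : Fin n → ℕ} (hα : IsSpread k α) {b : ℕ}
    (hle : ∀ j, α j ≤ b + (n - 1) * k) (v : ℕ) :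
    #{j : Fin n | v + b ≤ α j} ≤ #{i : Fin n | v ≤ i * k} := by
  set T : Finset (Fin n) := {j : Fin n | v + b ≤ α j} with hT
  obtain hc | ⟨M, hc⟩ : #T = 0 ∨ ∃ M, #T = M + 1 := by
    cases #T <;> simp
  · omega
  obtain ⟨j, -, -, h, -⟩ := hα.exists_max (lo := v + b) M T hc
    (fun i hi => (mem_filter.1 hi).2)
  have hTn : #T ≤ n := by simpa using card_le_univ T
  have h1 := hle j
  have h2 : v ≤ (n - 1 - M) * k := by
    rw [Nat.sub_mul]; omega
  have h3 : (univ.filter fun i : Fin n => n - #T ≤ (i : ℕ)) ⊆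
      univ.filter fun i : Fin n => v ≤ i * k := by
    intro i hi
    simp only [mem_filter, mem_univ, true_and] at hi ⊢
    refine h2.trans (Nat.mul_le_mul_right _ (by omega))
  refine le_trans (le_of_eq ?_) (card_le_card h3)
  have h4 := Fin.card_filter_val_lt (n := n) (m := n - #T)
  have h5 := card_filter_add_card_filter_not (s := (univ : Finset (Fin n)))
    (fun i : Fin n => (i : ℕ) < n - #T)
  simp only [not_lt, card_univ, Fintype.card_fin] at h5
  omega

open Finset in
theorem IsSpread.card_filter_lt_le {n k : ℕ} {α : Fin n → ℕ} (hα : IsSpread k α) (a r v : ℕ) :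
    #{j : Fin n | α j + (a + if r ≤ (j : ℕ) then 1 else 0) < v} ≤
      #{i : Fin n | i * k + (a + if r ≤ (i : ℕ) then 1 else 0) < v} := by
  set S : Finset (Fin n) := {j : Fin n | α j + (a + if r ≤ (j : ℕ) then 1 else 0) < v} with hS
  obtain hc | ⟨N, hc⟩ : #S = 0 ∨ ∃ N, #S = N + 1 := by
    cases #S <;> simp
  · omega
  obtain ⟨j, hj, -, h1, h2⟩ := hα.exists_max (lo := 0) N S hc (fun i _ => Nat.zero_le _)
  have hSn : #S ≤ n := by simpa using card_le_univ S
  have hj' := (mem_filter.1 hj).2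
  have h3 : N * k + (a + if r ≤ N then 1 else 0) < v := by
    by_cases hr : r ≤ N
    · by_cases hrj : r ≤ (j : ℕ)
      · rw [if_pos hrj] at hj'
        rw [if_pos hr]
        omega
      -- Since `j < r ≤ N`, the `N + 1` elements of `S` do not fit into `Iic j`. A later index
      -- forces a descent, whose extra unit replaces the missing `1` at `j`.
      · obtain ⟨i, hi, hij⟩ : ∃ i ∈ S, j < i := by
          by_contra! hcon
          have h4 : S ⊆ Iic j := fun i hi => mem_Iic.2 (hcon i hi)
          have h5 := card_le_card h4
          rw [Fin.card_Iic] at h5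
          omega
        have := h2 i hi hij
        rw [if_pos hr]
        omega
    · rw [if_neg hr]
      omega
  have h4 : (univ.filter fun i : Fin n => (i : ℕ) < N + 1) ⊆
      univ.filter fun i : Fin n => i * k + (a + if r ≤ (i : ℕ) then 1 else 0) < v := by
    intro i hi
    simp only [mem_filter, mem_univ, true_and] at hi ⊢
    have h5 : (i : ℕ) * k ≤ N * k := Nat.mul_le_mul_right _ (by omega)
    split_ifs at h3 ⊢ <;> omega
  refine le_trans (le_of_eq ?_) (card_le_card h4)
  rw [Fin.card_filter_val_lt]
  omega

-- Count complements: an index fails either because its interval lies above `v` or because it lies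
-- below. Each kind of failure is at most as frequent for `α` as for the model configuration `i *
-- k`.
open Finset in
theorem IsSpread.card_filter_le {n k : ℕ} {α : Fin n → ℕ} (hα : IsSpread k α) {b : ℕ}
    (hle : ∀ j, α j ≤ b + (n - 1) * k) (a r v : ℕ) :
    #{i : Fin n | i * k < v ∧ v ≤ i * k + (a + if r ≤ (i : ℕ) then 1 else 0)} ≤
      #{j : Fin n | α j < v + b ∧ v ≤ α j + (a + if r ≤ (j : ℕ) then 1 else 0)} := by
  have split : ∀ (p q : Fin n → Prop) [DecidablePred p] [DecidablePred q],
      (∀ i, p i → ¬ q i) →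
      #{i : Fin n | p i} + #{i : Fin n | q i} + #{i : Fin n | ¬ p i ∧ ¬ q i} = n := by
    intro p q _ _ hpq
    have h1 := card_filter_add_card_filter_not (s := (univ : Finset (Fin n)))
      (fun i => p i)
    have h2 := card_filter_add_card_filter_not (s := univ.filter fun i : Fin n => ¬ p i)
      (fun i => q i)
    rw [filter_filter, filter_filter] at h2
    have h3 : (univ.filter fun i : Fin n => ¬ p i ∧ q i) = univ.filter fun i => q i :=
      filter_congr fun i _ => ⟨fun h => h.2, fun h => ⟨fun h' => hpq i h' h, h⟩⟩
    rw [h3] at h2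
    simp only [card_univ, Fintype.card_fin] at h1
    omega
  have h1 := hα.card_filter_ge_le hle v
  have h2 := hα.card_filter_lt_le a r v
  have h3 := split (fun i => v ≤ i * k)
    (fun i => i * k + (a + if r ≤ (i : ℕ) then 1 else 0) < v) (fun i h => by omega)
  have h4 := split (fun j => v + b ≤ α j)
    (fun j => α j + (a + if r ≤ (j : ℕ) then 1 else 0) < v) (fun i h => by omega)
  simp only [not_le, not_lt] at h3 h4
  omega

open Finset in
theorem IsSpread.eq_of_le {n k : ℕ} {α : Fin n → ℕ} (hα : IsSpread k α) {b : ℕ}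
    (hge : ∀ j, b ≤ α j) (hle : ∀ j, α j ≤ b + (n - 1) * k) (j : Fin n) : α j = b + j * k := by
  induction n with
  | zero => exact j.elim0
  | succ n ih =>
    obtain ⟨p, -, hmax, h1, h2⟩ := hα.exists_max n univ (by simp) (fun i _ => hge i)
    have h3 := hle p
    rw [Nat.add_sub_cancel] at h3
    -- A maximum at any other index would gain the extra unit of a descent and exceed the upper
    -- bound.
    have hp : p = Fin.last n := by
      by_contra hne
      have := h2 (Fin.last n) (mem_univ _) (Fin.lt_last_iff_ne_last.2 hne)
      omega
    subst hp
    refine Fin.lastCases ?_ (fun i => ?_) j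
    · rw [Fin.val_last]; omega
    · refine ih (α := fun i => α i.castSucc) (fun i j hij => hα _ _ (by simpa using hij))
        (fun j => hge _) (fun j => ?_) i
      have h4 := hmax j.castSucc (mem_univ _)
      have hn : n * k = (n - 1) * k + k := by
        have := j.pos
        obtain ⟨n, rfl⟩ := Nat.exists_eq_succ_of_ne_zero this.ne'
        simp [Nat.succ_mul]
      rcases hα j.castSucc (Fin.last n) (Fin.castSucc_lt_last j) with h | h <;> omega
-- Specialization to the matrix `B_A`
theorem matrixA_self (n m a b k : ℕ) (i : Fin (n + 1)) : matrixA n m a b k i i = 0 := by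
  simp [matrixA]

theorem matrixA_zero_succ (n m a b k : ℕ) (j : Fin n) : matrixA n m a b k 0 j.succ = b := by
  simp [matrixA, (Fin.succ_ne_zero j).symm]

theorem matrixA_succ_zero (n m a b k : ℕ) (j : Fin n) :
    matrixA n m a b k j.succ 0 = a + if n - m ≤ (j : ℕ) then 1 else 0 := by
  simp only [matrixA, Matrix.of_apply, Fin.succ_ne_zero, if_false, if_true, Fin.val_succ,
    Nat.lt_succ_iff]
  split_ifs <;> rfl

theorem matrixA_succ_succ (n m a b k : ℕ) {i j : Fin n} (h : i ≠ j) :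
    matrixA n m a b k i.succ j.succ = k := by
  simp [matrixA, h]

theorem sum_matrixA (n m a b k : ℕ) :
    (fun j => ∑ i, matrixA n m a b k i j) =
      Fin.cons (∑ j : Fin n, (a + if n - m ≤ (j : ℕ) then 1 else 0))
        fun _ => b + (n - 1) * k := by
  funext j
  rw [Fin.sum_univ_succ]
  refine Fin.cases ?_ (fun j => ?_) j
  · simp only [matrixA_self, matrixA_succ_zero, zero_add, Fin.cons_zero]
  · rw [matrixA_zero_succ, Fin.cons_succ, ← Finset.add_sum_erase _ _ (Finset.mem_univ j),
      matrixA_self, zero_add, Finset.sum_congr rfl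
        (fun i hi => matrixA_succ_succ n m a b k (Finset.ne_of_mem_erase hi))]
    simp

open Finset in
theorem aeval_dysonPoly_matrixA {K S : Type*} [Field K] [CommRing S] [Algebra K S] (q : K)
    (n m a b k : ℕ) (x : S) (c : Fin n → S) :
    MvPolynomial.aeval (Fin.cons x c : Fin (n + 1) → S) (dysonPoly q (matrixA n m a b k)) =
      (∏ j, ((∏ t ∈ range b, (c j - algebraMap K S (q ^ t) * x)) *
        ∏ t ∈ range (a + if n - m ≤ (j : ℕ) then 1 else 0),
          (x - algebraMap K S (q ^ (t + 1)) * c j))) *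
      ∏ i, ∏ j ∈ Ioi i, ((∏ t ∈ range k, (c j - algebraMap K S (q ^ t) * c i)) *
        ∏ t ∈ range k, (c i - algebraMap K S (q ^ (t + 1)) * c j)) := by
  rw [dysonPoly, map_prod, Fin.prod_univ_succ, Fin.prod_Ioi_zero, map_prod]
  congr 1
  · refine prod_congr rfl fun j _ => ?_
    rw [matrixA_zero_succ, matrixA_succ_zero]
    simp
  · refine prod_congr rfl fun i _ => ?_
    rw [Fin.prod_Ioi_succ, map_prod]
    refine prod_congr rfl fun j hj => ?_
    have hij : i ≠ j := (mem_Ioi.1 hj).ne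
    rw [matrixA_succ_succ _ _ _ _ _ hij, matrixA_succ_succ _ _ _ _ _ hij.symm]
    simp

-- For `i < j` the first product contains a zero when `0 ≤ α j - α i < k`, the second when `1 ≤ α i
-- - α j ≤ k`. This is the source of the asymmetry between ascents and descents in `IsSpread`.
open Finset in
theorem prod_pairs_eq_zero {K S : Type*} [Field K] [CommRing S] [Algebra K S] (q : K)
    {n k : ℕ} {α : Fin n → ℕ} (hα : ¬ IsSpread k α) :
    ∏ i, ∏ j ∈ Ioi i,
      ((∏ t ∈ range k, (algebraMap K S (q ^ α j) - algebraMap K S (q ^ t) *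
          algebraMap K S (q ^ α i))) *
        ∏ t ∈ range k, (algebraMap K S (q ^ α i) - algebraMap K S (q ^ (t + 1)) *
          algebraMap K S (q ^ α j))) = 0 := by
  unfold IsSpread at hα
  push Not at hα
  obtain ⟨i, j, hij, h1, h2⟩ := hα
  refine prod_eq_zero (mem_univ i) (prod_eq_zero (mem_Ioi.2 hij) ?_)
  rcases le_or_gt (α i) (α j) with h | h
  · rw [prod_eq_zero (mem_range.2 (show α j - α i < k by omega)), zero_mul]
    rw [← map_mul, ← pow_add, Nat.sub_add_cancel h, sub_self]
  · rw [mul_comm, prod_eq_zero (mem_range.2 (show α i - α j - 1 < k by omega)), zero_mul]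
    rw [← map_mul, ← pow_add, show α i - α j - 1 + 1 + α j = α i by omega, sub_self]

/-! ### The common divisor and the single surviving node -/

open Finset Polynomial in
/-- The polynomial whose roots are the exceptional values of the distinguished variable. -/
noncomputable def nodePoly {K : Type*} [Field K] (q : K) (n r a k : ℕ) : K[X] :=
  ∏ i : Fin n, ∏ v ∈ Ioc (i * k) (i * k + (a + if r ≤ (i : ℕ) then 1 else 0)), (X - C (q ^ v))

open Finset Polynomial in
theorem nodePoly_monic {K : Type*} [Field K] (q : K) (n r a k : ℕ) :
    (nodePoly q n r a k).Monic :=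
  monic_prod_of_monic _ _ fun _ _ => monic_prod_of_monic _ _ fun _ _ => monic_X_sub_C _

open Finset Polynomial in
theorem natDegree_nodePoly {K : Type*} [Field K] (q : K) (n r a k : ℕ) :
    (nodePoly q n r a k).natDegree = ∑ j : Fin n, (a + if r ≤ (j : ℕ) then 1 else 0) := by
  rw [nodePoly, natDegree_prod_of_monic _ _
    fun _ _ => monic_prod_of_monic _ _ fun _ _ => monic_X_sub_C _]
  refine sum_congr rfl fun i _ => ?_
  rw [natDegree_prod_of_monic _ _ fun _ _ => monic_X_sub_C _]
  simp only [natDegree_X_sub_C, sum_const, Nat.card_Ioc, smul_eq_mul, mul_one,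
    Nat.add_sub_cancel_left]

-- Compare multiplicities root by root: `q^v` is a root of the `j`-th factor when `α j < v + b` and
-- `v` is at most `α j` plus the length of the second product, which is the count bounded by
-- `IsSpread.card_filter_le`. Powers of distinct linear factors are coprime.
open Finset Polynomial in
theorem nodePoly_dvd {K : Type*} [Field K] {q : K} (hq : Function.Injective fun v : ℕ => q ^ v)
    {n k b : ℕ} (r a : ℕ) {α : Fin n → ℕ} (hα : IsSpread k α)
    (hle : ∀ j, α j ≤ b + (n - 1) * k) :
    nodePoly q n r a k ∣ ∏ j, ((∏ t ∈ range b, (C (q ^ α j) - C (q ^ t) * X)) *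
      ∏ t ∈ range (a + if r ≤ (j : ℕ) then 1 else 0), (X - C (q ^ (t + 1)) * C (q ^ α j))) := by
  -- The range only has to contain every exponent `v ≤ i * k + a + 1` that occurs.
  have h1 : nodePoly q n r a k = ∏ v ∈ range (n * k + a + 2), (X - C (q ^ v)) ^
      #{i : Fin n | i * k < v ∧ v ≤ i * k + (a + if r ≤ (i : ℕ) then 1 else 0)} := by
    have h2 : ∀ i : Fin n,
        ∏ v ∈ Ioc (i * k) (i * k + (a + if r ≤ (i : ℕ) then 1 else 0)), (X - C (q ^ v)) =
          ∏ v ∈ range (n * k + a + 2),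
            if i * k < v ∧ v ≤ i * k + (a + if r ≤ (i : ℕ) then 1 else 0) then
              (X - C (q ^ v)) else 1 := by
      intro i
      rw [← prod_filter]
      refine prod_congr ?_ fun _ _ => rfl
      ext v
      simp only [mem_Ioc, mem_filter, mem_range, iff_and_self]
      intro hv
      have h3 : (i : ℕ) * k ≤ n * k := Nat.mul_le_mul_right _ i.is_lt.le
      split_ifs at hv <;> omega
    rw [nodePoly, prod_congr rfl fun i _ => h2 i, prod_comm]
    refine prod_congr rfl fun v _ => ?_
    rw [← prod_filter, prod_const]
  rw [h1]
  refine prod_dvd_of_coprime (fun u _ v _ huv => ?_) fun v _ => ?_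
  · exact (pairwise_coprime_X_sub_C hq huv).pow
  · refine (pow_dvd_pow _ (hα.card_filter_le hle a r v)).trans ?_
    rw [← prod_const]
    refine (prod_dvd_prod_of_dvd _ _ fun j hj => ?_).trans
      (prod_dvd_prod_of_subset _ _ _ (filter_subset _ _))
    obtain ⟨-, h3, h4⟩ := mem_filter.1 hj
    -- Roots with `v ≤ α j` come from the `b` factors, the larger ones from the second product.
    rcases le_or_gt v (α j) with h | h
    · refine Dvd.dvd.mul_right (Dvd.dvd.trans ?_
        (dvd_prod_of_mem _ (mem_range.2 (show α j - v < b by omega)))) _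
      refine ⟨-C (q ^ (α j - v)), ?_⟩
      have h5 : C (q ^ α j) = C (q ^ v) * C (q ^ (α j - v)) := by
        rw [← C_mul, ← pow_add, Nat.add_sub_cancel' h]
      rw [h5]
      ring
    · refine Dvd.dvd.mul_left (Dvd.dvd.trans ?_
        (dvd_prod_of_mem _ (mem_range.2 (show v - α j - 1 < _ by omega)))) _
      rw [← C_mul, ← pow_add, show v - α j - 1 + 1 + α j = v by omega]

open Finset Polynomial in
/-- The interpolation formula for the constant term reduces to a single node. -/
theorem constTerm_laurentL_matrixA {K : Type*} [Field K] {q : K}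
    (hq : Function.Injective fun v : ℕ => q ^ v) (n m a b k : ℕ) :
    constTerm (laurentL q (matrixA n m a b k)) * (nodePoly q n (n - m) a k).eval 1 =
      (∏ j : Fin n, (∏ s ∈ (range (b + (n - 1) * k + 1)).erase (b + j * k),
        (q ^ (b + j * k) - q ^ s))⁻¹) *
      ((∏ j : Fin n, ((∏ t ∈ range b, (q ^ (b + j * k) - q ^ t)) *
        ∏ t ∈ range (a + if n - m ≤ (j : ℕ) then 1 else 0),
          (1 - q ^ (t + 1) * q ^ (b + j * k)))) *
      ∏ i : Fin n, ∏ j ∈ Ioi i, ((∏ t ∈ range k, (q ^ (b + j * k) - q ^ t * q ^ (b + i * k))) *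
        ∏ t ∈ range k, (q ^ (b + i * k) - q ^ (t + 1) * q ^ (b + j * k)))) := by
  have hdeg : (dysonPoly q (matrixA n m a b k)).totalDegree ≤
      (∑ j : Fin n, (a + if n - m ≤ (j : ℕ) then 1 else 0)) + n * (b + (n - 1) * k) := by
    refine (totalDegree_dysonPoly_le _ _).trans (le_of_eq ?_)
    rw [sum_Ioi_eq (matrixA_self n m a b k), sum_matrixA, Fin.sum_univ_succ]
    simp
  have hdvd : ∀ α ∈ Fintype.piFinset (fun _ : Fin n => range (b + (n - 1) * k + 1)),
      nodePoly q n (n - m) a k ∣ MvPolynomial.aeval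
        (Fin.cons X (fun j => C (q ^ α j)) : Fin (n + 1) → K[X])
          (dysonPoly q (matrixA n m a b k)) := by
    intro α hα
    rw [aeval_dysonPoly_matrixA]
    by_cases hs : IsSpread k α
    · refine Dvd.dvd.mul_right (nodePoly_dvd hq _ _ hs fun j => ?_) _
      exact Nat.lt_succ_iff.1 (mem_range.1 (Fintype.mem_piFinset.1 hα j))
    · have := prod_pairs_eq_zero (S := K[X]) q hs
      simp only [algebraMap_eq] at this ⊢
      rw [this, mul_zero]
      exact dvd_zero _
  rw [constTerm_laurentL q (matrixA_self n m a b k), sum_matrixA,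
    coeff_mul_eval_eq_sum (v := fun s => q ^ s) hq.injOn hdeg (nodePoly_monic _ _ _ _ _)
      (natDegree_nodePoly _ _ _ _ _) hdvd]
  rw [sum_eq_single fun j : Fin n => b + j * k]
  · congr 1
    rw [← MvPolynomial.coe_aeval_eq_eval, RingHom.coe_coe, aeval_dysonPoly_matrixA]
    simp
  · intro α hα hne
    rw [← MvPolynomial.coe_aeval_eq_eval, RingHom.coe_coe, aeval_dysonPoly_matrixA]
    by_cases hs : IsSpread k α
    · have : ∃ j, α j < b := by
        by_contra! hcon
        exact hne (funext fun j => hs.eq_of_le hcon (fun j =>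
          Nat.lt_succ_iff.1 (mem_range.1 (Fintype.mem_piFinset.1 hα j))) j)
      obtain ⟨j, hj⟩ := this
      refine mul_eq_zero_of_right _ (mul_eq_zero_of_left ?_ _)
      refine prod_eq_zero (mem_univ j) (mul_eq_zero_of_left ?_ _)
      refine prod_eq_zero (mem_range.2 hj) ?_
      simp
    · have := prod_pairs_eq_zero (S := K) q hs
      simp only [Algebra.algebraMap_self_apply] at this ⊢
      rw [this, mul_zero, mul_zero]
  · intro h
    refine absurd (Fintype.mem_piFinset.2 fun j => mem_range.2 ?_) h
    have : (j : ℕ) * k ≤ (n - 1) * k := Nat.mul_le_mul_right _ (by omega)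
    omega

/-! ### Evaluation of the surviving term by `q`-factorials -/

open Finset in
theorem qShifted_add {K : Type*} [Field K] (q : K) (M N : ℕ) :
    qShifted q q (M + N) = qShifted q q M * ∏ t ∈ range N, (1 - q ^ (M + t + 1)) := by
  rw [qShifted, prod_range_add, qShifted]
  congr 1
  exact prod_congr rfl fun t _ => by ring

open Finset in
theorem qShifted_ne_zero {K : Type*} [Field K] {q : K}
    (hq : Function.Injective fun v : ℕ => q ^ v) (N : ℕ) : qShifted q q N ≠ 0 := by
  refine prod_ne_zero_iff.2 fun s _ h => ?_
  have h1 : q ^ (s + 1) = q ^ 0 := by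
    rw [pow_zero, pow_succ']; exact (sub_eq_zero.1 h).symm
  exact absurd (hq h1) (Nat.succ_ne_zero s)

open Finset in
theorem prod_range_prod_range_eq {M : Type*} [CommMonoid M] (g : ℕ → M) (k N : ℕ) :
    ∏ r ∈ range N, ∏ t ∈ range k, g (r * k + t) = ∏ s ∈ range (N * k), g s := by
  induction N with
  | zero => simp
  | succ N ih => rw [prod_range_succ, ih, Nat.succ_mul, prod_range_add]

open Finset in
theorem prod_range_erase {M : Type*} [CommMonoid M] (g : ℕ → M) (p r : ℕ) :
    ∏ s ∈ (range (p + 1 + r)).erase p, g s =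
      (∏ s ∈ range p, g s) * ∏ s ∈ range r, g (p + 1 + s) := by
  have h : (range (p + 1 + r)).erase p = range p ∪ Ico (p + 1) (p + 1 + r) := by
    ext s
    simp only [mem_erase, mem_range, mem_union, mem_Ico]
    omega
  rw [h, prod_union, prod_Ico_eq_prod_range, Nat.add_sub_cancel_left]
  refine disjoint_left.2 fun s hs hs' => ?_
  rw [mem_range] at hs
  rw [mem_Ico] at hs'
  omega

open Finset in
theorem prod_univ_prod_Ioi_eq {M : Type*} [CommMonoid M] (n : ℕ) (f : ℕ → ℕ → M) :
    ∏ i : Fin n, ∏ j ∈ Ioi i, f i j = ∏ i ∈ range n, ∏ j ∈ Ioo i n, f i j := by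
  rw [prod_range]
  refine prod_congr rfl fun i _ => ?_
  rw [← Fin.map_valEmbedding_Ioi, prod_map]
  rfl

open Finset in
theorem prod_ascents {K : Type*} [Field K] (q : K) (b k j : ℕ) :
    ∏ i ∈ range j, ∏ t ∈ range k, (q ^ (b + j * k) - q ^ t * q ^ (b + i * k)) =
      ∏ s ∈ range (j * k), (q ^ (b + j * k) - q ^ (b + s)) := by
  rw [← prod_range_prod_range_eq (fun s => q ^ (b + j * k) - q ^ (b + s))]
  refine prod_congr rfl fun i _ => prod_congr rfl fun t _ => ?_
  ring

-- The blocks for successive `j` join into one run of factors `1 - q^s` starting at `s = k + 1`;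
-- multiplying by `qShifted q q k` supplies the missing start.
open Finset in
theorem prod_descents {K : Type*} [Field K] (q : K) {n i : ℕ} (b k : ℕ) (hi : i < n) :
    qShifted q q k *
      ∏ j ∈ Ioo i n, ∏ t ∈ range k, (q ^ (b + i * k) - q ^ (t + 1) * q ^ (b + j * k)) =
      (q ^ (b + i * k)) ^ ((n - 1 - i) * k) * qShifted q q ((n - 1 - i) * k + k) := by
  have h1 : Ioo i n = Ico (i + 1) n := by ext; simp
  rw [h1, prod_Ico_eq_prod_range, show n - (i + 1) = n - 1 - i by omega]
  have h2 : ∏ r ∈ range (n - 1 - i), ∏ t ∈ range k,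
      (q ^ (b + i * k) - q ^ (t + 1) * q ^ (b + (i + 1 + r) * k)) =
      ∏ s ∈ range ((n - 1 - i) * k), (q ^ (b + i * k) * (1 - q ^ (k + s + 1))) := by
    rw [← prod_range_prod_range_eq (fun s => q ^ (b + i * k) * (1 - q ^ (k + s + 1)))]
    refine prod_congr rfl fun r _ => prod_congr rfl fun t _ => ?_
    ring
  rw [h2, prod_mul_distrib, prod_const, card_range, add_comm _ k, qShifted_add]
  ring

-- The nodes are cut at `b` and at `b + j * k`. The first block cancels the `b` factors of the
-- surviving term, the second cancels `prod_ascents`, and the power of `q` in the third cancels the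
-- one in `prod_descents`.
open Finset in
theorem prod_node {K : Type*} [Field K] (q : K) {n j : ℕ} (b k : ℕ) (hj : j < n) :
    ∏ s ∈ (range (b + (n - 1) * k + 1)).erase (b + j * k), (q ^ (b + j * k) - q ^ s) =
      (∏ t ∈ range b, (q ^ (b + j * k) - q ^ t)) *
      (∏ s ∈ range (j * k), (q ^ (b + j * k) - q ^ (b + s))) *
      ((q ^ (b + j * k)) ^ ((n - 1 - j) * k) * qShifted q q ((n - 1 - j) * k)) := by
  have h1 : b + (n - 1) * k + 1 = b + j * k + 1 + (n - 1 - j) * k := by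
    have : (n - 1) * k = j * k + (n - 1 - j) * k := by rw [← add_mul]; congr 1; omega
    omega
  rw [h1, prod_range_erase, prod_range_add]
  congr 1
  rw [qShifted, ← card_range ((n - 1 - j) * k), ← prod_const, card_range, ← prod_mul_distrib]
  exact prod_congr rfl fun s _ => by ring

open Finset in
theorem eval_nodePoly {K : Type*} [Field K] (q : K) (n r a k : ℕ) :
    (∏ j ∈ range n, qShifted q q (j * k)) * (nodePoly q n r a k).eval 1 =
      ∏ j ∈ range n, qShifted q q (j * k + (a + if r ≤ j then 1 else 0)) := by
  rw [nodePoly, Polynomial.eval_prod, prod_range, prod_range, ← prod_mul_distrib]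
  refine prod_congr rfl fun j _ => ?_
  rw [qShifted_add, Polynomial.eval_prod]
  congr 1
  have h : Ioc ((j : ℕ) * k) (j * k + (a + if r ≤ (j : ℕ) then 1 else 0)) =
      Ico (j * k + 1) (j * k + 1 + (a + if r ≤ (j : ℕ) then 1 else 0)) := by
    ext; simp only [mem_Ioc, mem_Ico]; omega
  rw [h, prod_Ico_eq_prod_range, Nat.add_sub_cancel_left]
  refine prod_congr rfl fun t _ => ?_
  rw [Polynomial.eval_sub, Polynomial.eval_X, Polynomial.eval_C, add_right_comm]

open Finset in
/-- The `q`-Morris identity in Aomoto's form. -/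
theorem constTerm_laurentL_matrixA_eq {K : Type*} [Field K] {q : K}
    (hq : Function.Injective fun v : ℕ => q ^ v) (n m a b k : ℕ) :
    constTerm (laurentL q (matrixA n m a b k)) =
      ∏ j ∈ range n,
        (qShifted q q (a + b + k * j + (if n - m ≤ j then 1 else 0)) *
          qShifted q q (k * j + k)) /
        (qShifted q q (a + k * j + (if n - m ≤ j then 1 else 0)) *
          qShifted q q (b + k * j) * qShifted q q k) := by
  have hf := qShifted_ne_zero hq
  have hq0 : q ≠ 0 := by
    rintro rfl
    exact absurd (hq (show (0 : K) ^ 1 = 0 ^ 2 by simp)) (by decide)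
  have hnode : ∀ j p : ℕ, p ≠ j → q ^ j - q ^ p ≠ 0 := fun j p h h' =>
    h (hq (sub_eq_zero.1 h')).symm
  have main := constTerm_laurentL_matrixA hq n m a b k
  have hΦ := eval_nodePoly q n (n - m) a k
  have hasc : ∏ i ∈ range n, ∏ j ∈ Ioo i n, ∏ t ∈ range k,
      (q ^ (b + j * k) - q ^ t * q ^ (b + i * k)) =
      ∏ j ∈ range n, ∏ s ∈ range (j * k), (q ^ (b + j * k) - q ^ (b + s)) := by
    rw [prod_comm' (t' := range n) (s' := fun j => range j)]
    · exact prod_congr rfl fun j _ => prod_ascents q b k j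
    · intro i j
      simp only [mem_range, mem_Ioo]
      omega
  have hdesc : (∏ j ∈ range n, qShifted q q k) * ∏ i ∈ range n, ∏ j ∈ Ioo i n, ∏ t ∈ range k,
      (q ^ (b + i * k) - q ^ (t + 1) * q ^ (b + j * k)) =
      (∏ i ∈ range n, (q ^ (b + i * k)) ^ ((n - 1 - i) * k)) *
        ∏ i ∈ range n, qShifted q q (i * k + k) := by
    rw [← prod_mul_distrib, prod_congr rfl
      fun i hi => prod_descents q b k (mem_range.1 hi), prod_mul_distrib]
    congr 1
    -- Replacing `i` by `n - 1 - i` permutes the factors.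
    exact prod_range_reflect (fun i => qShifted q q (i * k + k)) n
  have hden : ∏ j ∈ range n, ∏ s ∈ (range (b + (n - 1) * k + 1)).erase (b + j * k),
        (q ^ (b + j * k) - q ^ s) =
      (∏ j ∈ range n, ∏ t ∈ range b, (q ^ (b + j * k) - q ^ t)) *
      (∏ j ∈ range n, ∏ s ∈ range (j * k), (q ^ (b + j * k) - q ^ (b + s))) *
      ((∏ i ∈ range n, (q ^ (b + i * k)) ^ ((n - 1 - i) * k)) *
        ∏ i ∈ range n, qShifted q q (i * k)) := by
    rw [prod_congr rfl fun i hi => prod_node q b k (mem_range.1 hi), prod_mul_distrib,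
      prod_mul_distrib, prod_mul_distrib]
    congr 2
    exact prod_range_reflect (fun i => qShifted q q (i * k)) n
  have hnum : (∏ j ∈ range n, qShifted q q (b + j * k)) *
      ∏ j ∈ range n, ∏ t ∈ range (a + if n - m ≤ j then 1 else 0),
        (1 - q ^ (t + 1) * q ^ (b + j * k)) =
      ∏ j ∈ range n, qShifted q q (b + j * k + (a + if n - m ≤ j then 1 else 0)) := by
    rw [← prod_mul_distrib]
    refine prod_congr rfl fun j _ => ?_
    rw [qShifted_add q (b + j * k)]
    congr 1
    exact prod_congr rfl fun t _ => by ring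
  rw [prod_univ_prod_Ioi_eq n (fun i j =>
    ((∏ t ∈ range k, (q ^ (b + j * k) - q ^ t * q ^ (b + i * k))) *
        ∏ t ∈ range k, (q ^ (b + i * k) - q ^ (t + 1) * q ^ (b + j * k)))),
    ← prod_range (fun j => ((∏ t ∈ range b, (q ^ (b + j * k) - q ^ t)) *
        ∏ t ∈ range (a + if n - m ≤ j then 1 else 0), (1 - q ^ (t + 1) * q ^ (b + j * k)))),
    ← prod_range (fun j => (∏ s ∈ (range (b + (n - 1) * k + 1)).erase (b + j * k),
        (q ^ (b + j * k) - q ^ s))⁻¹), prod_inv_distrib, hden] at main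
  simp only [prod_mul_distrib] at main
  rw [hasc] at main
  rw [prod_div_distrib, prod_mul_distrib, prod_mul_distrib, prod_mul_distrib]
  have e1 : ∀ j, a + b + k * j + (if n - m ≤ j then 1 else 0) =
      b + j * k + (a + if n - m ≤ j then 1 else 0) := fun j => by ring
  have e2 : ∀ j, a + k * j + (if n - m ≤ j then 1 else 0) =
      j * k + (a + if n - m ≤ j then 1 else 0) := fun j => by ring
  simp only [e1, e2]
  simp only [mul_comm k]
  rw [← hnum, ← hΦ]
  have n1 : ∏ j ∈ range n, ∏ t ∈ range b, (q ^ (b + j * k) - q ^ t) ≠ 0 :=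
    prod_ne_zero_iff.2 fun j _ => prod_ne_zero_iff.2 fun t ht =>
      hnode _ _ (by have := mem_range.1 ht; omega)
  have n2 : ∏ j ∈ range n, ∏ s ∈ range (j * k), (q ^ (b + j * k) - q ^ (b + s)) ≠ 0 :=
    prod_ne_zero_iff.2 fun j _ => prod_ne_zero_iff.2 fun t ht =>
      hnode _ _ (by have := mem_range.1 ht; omega)
  have n3 : ∏ i ∈ range n, (q ^ (b + i * k)) ^ ((n - 1 - i) * k) ≠ 0 :=
    prod_ne_zero_iff.2 fun j _ => pow_ne_zero _ (pow_ne_zero _ hq0)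
  have n4 : ∏ i ∈ range n, qShifted q q (i * k) ≠ 0 := prod_ne_zero_iff.2 fun j _ => hf _
  have n5 : ∏ i ∈ range n, qShifted q q (b + i * k) ≠ 0 := prod_ne_zero_iff.2 fun j _ => hf _
  have n6 : ∏ i ∈ range n, qShifted q q k ≠ 0 := prod_ne_zero_iff.2 fun j _ => hf _
  have n7 : ∏ j ∈ range n, qShifted q q (j * k + (a + if n - m ≤ j then 1 else 0)) ≠ 0 :=
    prod_ne_zero_iff.2 fun j _ => hf _
  rw [← hΦ] at n7
  have n8 := right_ne_zero_of_mul n7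
  rw [eq_div_iff (mul_ne_zero (mul_ne_zero n7 n5) n6)]
  generalize (∏ j ∈ range n, ∏ t ∈ range b, (q ^ (b + j * k) - q ^ t)) = P1 at *
  generalize (∏ j ∈ range n, ∏ s ∈ range (j * k), (q ^ (b + j * k) - q ^ (b + s))) = P2 at *
  generalize (∏ i ∈ range n, (q ^ (b + i * k)) ^ ((n - 1 - i) * k)) = P3 at *
  generalize (∏ i ∈ range n, qShifted q q (i * k)) = P4 at *
  generalize (∏ i ∈ range n, qShifted q q (b + i * k)) = P5 at *
  generalize (∏ i ∈ range n, qShifted q q k) = P6 at *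
  generalize (∏ i ∈ range n, qShifted q q (i * k + k)) = P7 at *
  generalize (∏ i ∈ range n, ∏ j ∈ Ioo i n, ∏ t ∈ range k,
      (q ^ (b + i * k) - q ^ (t + 1) * q ^ (b + j * k))) = P8 at *
  generalize (∏ j ∈ range n, ∏ t ∈ range (a + if n - m ≤ j then 1 else 0),
        (1 - q ^ (t + 1) * q ^ (b + j * k))) = P9 at *
  generalize (nodePoly q n (n - m) a k).eval 1 = E at *
  generalize constTerm (laurentL q (matrixA n m a b k)) = Z at *
  -- The blocks `P1` and `P2` occur in both numerator and denominator and cancel here.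
  have h1 : Z * E * (P3 * P4) = P9 * P8 := by
    rw [main]
    field_simp
  have h2 : P3 * (Z * (P4 * E * P5 * P6)) = P3 * (P5 * P9 * P7) := by
    linear_combination (P5 * P6) * h1 + (P5 * P9) * hdesc
  exact mul_left_cancel₀ n3 h2

theorem ratFunc_X_pow_injective : Function.Injective fun v : ℕ => (RatFunc.X : RatFunc ℚ) ^ v := by
  intro u v h
  have h1 : (Polynomial.X : Polynomial ℚ) ^ u = Polynomial.X ^ v := by
    apply RatFunc.algebraMap_injective ℚ
    simpa using h
  simpa using congrArg Polynomial.natDegree h1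

theorem corollary6p3 (n : ℕ) (hn : 0 < n) (a b k m : ℕ) (hm : m ≤ n) :
    constTerm (laurentL (RatFunc.X : RatFunc ℚ) (matrixA n m a b k)) =
      ∏ j ∈ Finset.range n,
        (qShifted (RatFunc.X : RatFunc ℚ) RatFunc.X
            (a + b + k * j + (if n - m ≤ j then 1 else 0)) *
          qShifted (RatFunc.X : RatFunc ℚ) RatFunc.X (k * j + k)) /
        (qShifted (RatFunc.X : RatFunc ℚ) RatFunc.X
            (a + k * j + (if n - m ≤ j then 1 else 0)) *
          qShifted (RatFunc.X : RatFunc ℚ) RatFunc.X (b + k * j) *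
          qShifted (RatFunc.X : RatFunc ℚ) RatFunc.X k) :=
  constTerm_laurentL_matrixA_eq ratFunc_X_pow_injective n m a b k
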